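/- For a non-negative integer $n$, let $b_8(n)$ denote the number of $8$-regular partitions of $n$, i.e. the number of partitions of $n$ into positive integers none of which is divisible by $8$. Let $n$ be a positive integer. Then $b_8(n)$ is odd if and only if $$24n+7 = p^{4a+1}m^2$$ for some prime $p$, some integer $a\ge 0$ and some positive integer $m$ with $p\nmid m$. Moreover, whenever $24n+7=p^{4a+1}m^2$ with $p$, $a$, $m$ as above, one has $p\equiv 7\pmod{24}$. -/

import Mathlib

/-- The number `b_ℓ(n)` of `ℓ`-regular partitions of `n`: partitions of `n` into positive integers
none of which is divisible by `ℓ`. -/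
def regularPartitionCount (ℓ n : ℕ) : ℕ :=
  (Nat.Partition.restricted n (fun i => ¬ ℓ ∣ i)).card

/-! Write P = ∏ (1 - q^k). Modulo 2 the generating function of b_8 is ∏ (1 - q^(8k)) / (1 - q^k) =
P^7 = P^3 · P^4. Gauss's identity turns P^3 into the series over triangular numbers, and the
pentagonal number theorem with Frobenius turns P^4 into the series over 4 times the generalized
pentagonal numbers. Completing squares, b_8(n) has the parity of the number of (u, x) in ℕ² with u²
+ 3x² = N, where N = 24n + 7.

Sorting by d = gcd(u, x) reduces this to primitive representations of M = N/d², again 7 mod 24. By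
Thue's lemma and the composition identity, these are half as many as the square roots of -3 mod M.
That root count is multiplicative, even for each modulus prime to 6 other than 1, and 2 for the
prime powers that occur; so the primitive count is odd exactly when M is a prime power.

Hence b_8(n) has the parity of the number of d with N/d² a prime power. If any exists, N = p^(2c+1)
m² with p ∤ m, the d are p^i m for 0 ≤ i ≤ c, and c + 1 is odd exactly when 2c + 1 = 4a + 1. -/

open PowerSeries PowerSeries.WithPiTopology Filter Topology

/-! ### Gauss's triangular number identity, finite form -/

/-- Partial products `∏_{s ≤ k < n} (1 - q^{2k+2}) / (1 - q^{2k+1})`, where `u k` stands for the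
inverse of `1 - q^{2k+1}`. -/
def gaussRatio {R : Type*} [CommRing R] (q : R) (u : ℕ → R) (s n : ℕ) : R :=
  ∏ k ∈ Finset.Ico s n, (1 - q ^ (2 * k + 2)) * u k

theorem gaussRatio_self {R : Type*} [CommRing R] (q : R) (u : ℕ → R) (n : ℕ) :
    gaussRatio q u n n = 1 := by simp [gaussRatio]

theorem gaussRatio_succ_right {R : Type*} [CommRing R] (q : R) (u : ℕ → R) {s n : ℕ}
    (h : s ≤ n) :
    gaussRatio q u s (n + 1) = gaussRatio q u s n * ((1 - q ^ (2 * n + 2)) * u n) := by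
  simp [gaussRatio, Finset.prod_Ico_succ_top h]

theorem gaussRatio_mul_one_sub {R : Type*} [CommRing R] {q : R} {u : ℕ → R}
    (hu : ∀ k, u k * (1 - q ^ (2 * k + 1)) = 1) {s n : ℕ} (h : s < n) :
    gaussRatio q u s n * (1 - q ^ (2 * s + 1)) =
      gaussRatio q u (s + 1) n * (1 - q ^ (2 * s + 2)) := by
  rw [gaussRatio, gaussRatio, Finset.prod_eq_prod_Ico_succ_bot h]
  linear_combination
    (1 - q ^ (2 * s + 2)) * (∏ k ∈ Finset.Ico (s + 1) n, (1 - q ^ (2 * k + 2)) * u k) * hu s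

/-- After multiplication by `u n`, the left side at `m = n` is the change in the first `n + 1` terms
of Shanks' sum when `n` grows by one. -/
theorem gaussRatio_telescope {R : Type*} [CommRing R] {q : R} {u : ℕ → R}
    (hu : ∀ k, u k * (1 - q ^ (2 * k + 1)) = 1) {m n : ℕ} (h : m ≤ n) :
    ∑ s ∈ Finset.range (m + 1), gaussRatio q u s n * q ^ (s * (2 * n + 1)) *
      ((1 - q ^ (2 * n + 2)) * q ^ (2 * s) - (1 - q ^ (2 * n + 1))) =
    gaussRatio q u m n * q ^ ((m + 1) * (2 * n + 1)) * (1 - q ^ (2 * m + 1)) := by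
  induction m with
  | zero => simp; ring
  | succ m ih =>
    rw [Finset.sum_range_succ, ih (by omega)]
    have := gaussRatio_mul_one_sub hu (show m < n by omega)
    linear_combination q ^ ((m + 1) * (2 * n + 1)) * this

/-- Shanks' finite form of Gauss's triangular number identity. -/
theorem sum_pow_triangular_eq {R : Type*} [CommRing R] {q : R} {u : ℕ → R}
    (hu : ∀ k, u k * (1 - q ^ (2 * k + 1)) = 1) (n : ℕ) :
    ∑ s ∈ Finset.range (n + 1), gaussRatio q u s n * q ^ (s * (2 * n + 1)) =
      ∑ j ∈ Finset.range (2 * n + 1), q ^ (j * (j + 1) / 2) := by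
  induction n with
  | zero => simp [gaussRatio_self]
  | succ n ih =>
    have e1 : (2 * n + 1) * (2 * n + 1 + 1) / 2 = (n + 1) * (2 * n + 1) := by
      rw [show (2 * n + 1) * (2 * n + 1 + 1) = 2 * ((n + 1) * (2 * n + 1)) by ring]; simp
    have e2 : (2 * n + 1 + 1) * (2 * n + 1 + 1 + 1) / 2 = (n + 1) * (2 * (n + 1) + 1) := by
      rw [show (2 * n + 1 + 1) * (2 * n + 1 + 1 + 1) = 2 * ((n + 1) * (2 * (n + 1) + 1)) by ring]
      simp
    rw [show 2 * (n + 1) + 1 = 2 * n + 1 + 1 + 1 by ring, Finset.sum_range_succ _ (2 * n + 1 + 1),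
      Finset.sum_range_succ _ (2 * n + 1), ← ih, e1, e2, Finset.sum_range_succ, gaussRatio_self,
      one_mul, show 2 * n + 1 + 1 + 1 = 2 * (n + 1) + 1 by ring]
    -- The term `s = n + 1` has supplied the last triangular power; the change in the other terms
    -- must supply the power with `j = 2 * n + 1`.
    congr 1
    have h := gaussRatio_telescope hu le_rfl (n := n)
    rw [gaussRatio_self] at h
    rw [← sub_eq_iff_eq_add', ← Finset.sum_sub_distrib]
    have key : (∑ s ∈ Finset.range (n + 1),
        (gaussRatio q u s (n + 1) * q ^ (s * (2 * (n + 1) + 1)) -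
          gaussRatio q u s n * q ^ (s * (2 * n + 1)))) =
        u n * ∑ s ∈ Finset.range (n + 1), gaussRatio q u s n * q ^ (s * (2 * n + 1)) *
      ((1 - q ^ (2 * n + 2)) * q ^ (2 * s) - (1 - q ^ (2 * n + 1))) := by
      rw [Finset.mul_sum]
      refine Finset.sum_congr rfl fun s hs => ?_
      rw [gaussRatio_succ_right q u (by simp at hs; omega)]
      linear_combination gaussRatio q u s n * q ^ (s * (2 * n + 1)) * hu n
    rw [key, h]
    linear_combination q ^ ((n + 1) * (2 * n + 1)) * hu n

theorem gaussRatio_zero_mul_prod {R : Type*} [CommRing R] {q : R} {u : ℕ → R}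
    (hu : ∀ k, u k * (1 - q ^ (2 * k + 1)) = 1) (n : ℕ) :
    gaussRatio q u 0 n * ∏ k ∈ Finset.range (2 * n), (1 - q ^ (k + 1)) =
      (∏ k ∈ Finset.range n, (1 - q ^ (2 * k + 2))) ^ 2 := by
  induction n with
  | zero => simp [gaussRatio_self]
  | succ n ih =>
    rw [gaussRatio_succ_right q u (Nat.zero_le n), show 2 * (n + 1) = 2 * n + 1 + 1 by ring,
      Finset.prod_range_succ, Finset.prod_range_succ, Finset.prod_range_succ, mul_pow, ← ih]
    linear_combination (gaussRatio q u 0 n * (∏ k ∈ Finset.range (2 * n), (1 - q ^ (k + 1))) *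
      (1 - q ^ (2 * n + 2)) ^ 2) * hu n

/-! ### Power series identities and `b_8` modulo 2 -/

/-- The power series `∑ X ^ (k (k + 1) / 2)` over the triangular numbers. -/
noncomputable def triangularSeries (R : Type*) [CommRing R] : R⟦X⟧ :=
  open Classical in .mk fun n => if ∃ k : ℕ, k * (k + 1) / 2 = n then 1 else 0

theorem triangular_injective : Function.Injective fun k : ℕ => k * (k + 1) / 2 := by
  refine StrictMono.injective (strictMono_nat_of_lt_succ fun k => ?_)
  rw [show (k + 1) * (k + 1 + 1) = k * (k + 1) + (k + 1) * 2 by ring,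
    Nat.add_mul_div_right _ _ two_pos]
  omega

theorem coeff_sum_pow_triangular (R : Type*) [CommRing R] {d m : ℕ} (h : d < m) :
    (∑ j ∈ Finset.range m, (X : R⟦X⟧) ^ (j * (j + 1) / 2)).coeff d =
      (triangularSeries R).coeff d := by
  classical
  simp only [map_sum, coeff_X_pow, triangularSeries, coeff_mk]
  split_ifs with hd
  · obtain ⟨k, rfl⟩ := hd
    rw [Finset.sum_eq_single k]
    · simp
    · intro b _ hb
      rw [if_neg fun e => hb (triangular_injective e).symm]
    · intro hk
      exfalso
      apply hk
      have : k ≤ k * (k + 1) / 2 := by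
        rcases k.eq_zero_or_pos with rfl | hk
        · simp
        · rw [Nat.le_div_iff_mul_le two_pos]; nlinarith
      simp; omega
  · exact Finset.sum_eq_zero fun j _ => if_neg fun e => hd ⟨j, e.symm⟩

theorem tendsto_gaussRatio (k : Type*) [Field k] [TopologicalSpace k] :
    Tendsto (fun n => gaussRatio (X : k⟦X⟧) (fun i => (1 - X ^ (2 * i + 1))⁻¹) 0 n) atTop
      (𝓝 (triangularSeries k)) := by
  have hu (i : ℕ) : (1 - (X : k⟦X⟧) ^ (2 * i + 1))⁻¹ * (1 - X ^ (2 * i + 1)) = 1 :=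
    PowerSeries.inv_mul_cancel _ (by simp)
  rw [tendsto_iff_coeff_tendsto]
  refine fun d => tendsto_atTop_of_eventually_const (i₀ := d) fun n (hn : d ≤ n) => ?_
  -- In Shanks' sum, terms with `s ≥ 1` have order above `d`, so only `s = 0` reaches this
  -- coefficient.
  rw [← coeff_sum_pow_triangular k (show d < 2 * n + 1 by omega), ← sum_pow_triangular_eq hu,
    Finset.sum_range_succ', map_add, map_sum, Finset.sum_eq_zero]
  · simp
  · intro s _
    refine coeff_of_lt_order _ ?_
    rw [mul_comm]
    grw [← le_order_mul, order_X_pow]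
    refine lt_add_of_lt_of_nonneg ?_ (by simp)
    norm_cast
    nlinarith

theorem tendsto_prod_pentagonalSeries (R : Type*) [CommRing R] [TopologicalSpace R] :
    Tendsto (fun n => ∏ k ∈ Finset.range n, (1 - (X : R⟦X⟧) ^ (k + 1))) atTop
      (𝓝 (pentagonalSeries R)) :=
  (hasProd_one_sub_X_pow R).tendsto_prod_nat

instance charP_two_powerSeries : CharP (ZMod 2)⟦X⟧ 2 :=
  charP_of_injective_algebraMap (algebraMap (ZMod 2) (ZMod 2)⟦X⟧).injective 2

theorem pentagonalSeries_ne_zero (R : Type*) [CommRing R] [Nontrivial R] :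
    pentagonalSeries R ≠ 0 := by
  intro h
  have := coeff_pentagonalSeries_pentagonal R 0
  simp [h] at this

/-- Gauss's product times P is ∏ (1 - q^(2k))², which is P^4 in characteristic 2; then cancel P. -/
theorem pentagonalSeries_pow_three : pentagonalSeries (ZMod 2) ^ 3 = triangularSeries (ZMod 2) := by
  set P := pentagonalSeries (ZMod 2) with hP
  have hu (i : ℕ) : (1 - (X : (ZMod 2)⟦X⟧) ^ (2 * i + 1))⁻¹ * (1 - X ^ (2 * i + 1)) = 1 :=
    PowerSeries.inv_mul_cancel _ (by simp)
  have h1 := (tendsto_gaussRatio (ZMod 2)).mul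
    ((tendsto_prod_pentagonalSeries (ZMod 2)).comp
      (tendsto_id.const_mul_atTop' (show 0 < 2 by norm_num)))
  have h2 := (tendsto_prod_pentagonalSeries (ZMod 2)).pow 4
  have h3 : triangularSeries (ZMod 2) * P = P ^ 4 := by
    refine tendsto_nhds_unique h1 (h2.congr fun n => ?_)
    simp only [Function.comp, id]
    rw [gaussRatio_zero_mul_prod hu, show 4 = 2 * 2 from rfl, pow_mul, ← Finset.prod_pow]
    congr 1
    refine Finset.prod_congr rfl fun k _ => ?_
    rw [sub_pow_char, one_pow, ← pow_mul]
    ring_nf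
  apply mul_right_cancel₀ (pentagonalSeries_ne_zero (ZMod 2))
  rw [← hP, h3]; ring

theorem sum_range_eight_pow_eq {R : Type*} [CommRing R] [CharP R 2] (y : R) :
    ∑ j ∈ Finset.range 8, y ^ j = (1 - y) ^ 7 := by
  have h2 : (2 : R) = 0 := CharP.cast_eq_zero R 2
  simp only [Finset.sum_range_succ, Finset.sum_range_zero]
  linear_combination (4 * y - 10 * y ^ 2 + 18 * y ^ 3 - 17 * y ^ 4 + 11 * y ^ 5 - 3 * y ^ 6 + y ^ 7) * h2

open Nat.Partition in
-- By Glaisher's theorem one may count partitions with each part used fewer than 8 times; each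
-- factor 1 + y + ⋯ + y^7 is (1 - y)^7 modulo 2.
theorem mk_regularPartitionCount_eight :
    (PowerSeries.mk fun n => (regularPartitionCount 8 n : ZMod 2)) =
      pentagonalSeries (ZMod 2) ^ 7 := by
  have h := powerSeriesMk_card_restricted_eq_powerSeriesMk_card_countRestricted (ZMod 2)
    (show 0 < 8 by norm_num)
  have h1 := (hasProd_powerSeriesMk_card_countRestricted (ZMod 2)
    (show 0 < 8 by norm_num)).tendsto_prod_nat
  have h2 := (tendsto_prod_pentagonalSeries (ZMod 2)).pow 7
  simp only [regularPartitionCount]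
  rw [h]
  refine tendsto_nhds_unique h1 (h2.congr fun n => ?_)
  rw [← Finset.prod_pow]
  refine Finset.prod_congr rfl fun k _ => ?_
  simp_rw [pow_mul]
  rw [sum_range_eight_pow_eq]

theorem hasSum_pentagonalSeries_pow_four :
    HasSum (fun k : ℤ => (X : (ZMod 2)⟦X⟧) ^ (4 * pentagonal k))
      (pentagonalSeries (ZMod 2) ^ 4) := by
  have h := (hasSum_pentagonalSeries (ZMod 2)).map (iterateFrobenius (ZMod 2)⟦X⟧ 2 2)
    (by simpa [iterateFrobenius_def] using! continuous_pow 4)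
  have e (k : ℤ) : ((Int.negOnePow k : ℤ) : (ZMod 2)⟦X⟧) = 1 := by
    rcases Int.even_or_odd k with hk | hk
    · simp [Int.negOnePow_even k hk]
    · simp [Int.negOnePow_odd k hk, CharTwo.neg_eq]
  convert h using 1
  swap
  · simp [iterateFrobenius_def]
  ext1 k
  simp [e, iterateFrobenius_def, ← pow_mul, mul_comm]

open Classical in
theorem coeff_pentagonalSeries_pow_four (j : ℕ) :
    (pentagonalSeries (ZMod 2) ^ 4).coeff j =
      if ∃ k : ℤ, 4 * pentagonal k = j then 1 else 0 := by
  have h := hasSum_pentagonalSeries_pow_four.map (coeff j) (continuous_coeff (ZMod 2) j)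
  refine h.unique ?_
  split_ifs with hj
  · obtain ⟨k, rfl⟩ := hj
    convert hasSum_ite_eq k (1 : ZMod 2) using 1
    ext1 b
    simp [coeff_X_pow, eq_comm]
  · convert hasSum_zero using 1
    ext1 b
    simp only [Function.comp, coeff_X_pow]
    exact if_neg fun e => hj ⟨b, e.symm⟩

open Classical in
theorem regularPartitionCount_eight_cast (n : ℕ) :
    (regularPartitionCount 8 n : ZMod 2) =
      ({x ∈ Finset.HasAntidiagonal.antidiagonal n | (∃ k : ℕ, k * (k + 1) / 2 = x.1) ∧
        ∃ k : ℤ, 4 * pentagonal k = x.2}).card := by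
  have h := congrArg (coeff n) mk_regularPartitionCount_eight
  rw [show 7 = 3 + 4 from rfl, pow_add, pentagonalSeries_pow_three, coeff_mul, coeff_mk] at h
  rw [h, Finset.card_filter]
  push_cast
  refine Finset.sum_congr rfl fun x _ => ?_
  rw [coeff_pentagonalSeries_pow_four, triangularSeries, coeff_mk, ite_and]
  split_ifs <;> simp

/-! ### Representations by u² + 3x² -/

/-- The representations `u ^ 2 + 3 * x ^ 2 = N` by natural numbers. -/
def sqAddThreeSqReps (N : ℕ) : Finset (ℕ × ℕ) :=
  {x ∈ Finset.range (N + 1) ×ˢ Finset.range (N + 1) | x.1 ^ 2 + 3 * x.2 ^ 2 = N}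

theorem mem_sqAddThreeSqReps {N : ℕ} {x : ℕ × ℕ} :
    x ∈ sqAddThreeSqReps N ↔ x.1 ^ 2 + 3 * x.2 ^ 2 = N := by
  simp only [sqAddThreeSqReps, Finset.mem_filter, Finset.mem_product, Finset.mem_range,
    and_iff_right_iff_imp]
  rintro rfl
  constructor <;> nlinarith [sq_nonneg x.1, sq_nonneg x.2]

/-- These congruences ensure that every representation comes from a triangular and a pentagonal
number. -/
theorem residues_of_sq_add_three_sq {u x N : ℕ} (hN : N % 24 = 7) (h : u ^ 2 + 3 * x ^ 2 = N) :
    x % 2 = 1 ∧ (u % 12 = 2 ∨ u % 12 = 10) := by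
  have key : ∀ a < 24, ∀ b < 24, (a ^ 2 + 3 * b ^ 2) % 24 = 7 →
      b % 2 = 1 ∧ (a % 12 = 2 ∨ a % 12 = 10) := by decide
  have := key (u % 24) (Nat.mod_lt _ (by norm_num)) (x % 24) (Nat.mod_lt _ (by norm_num)) (by
    rw [← hN, ← h, Nat.add_mod, Nat.mul_mod, ← Nat.pow_mod, ← Nat.pow_mod]
    simp [Nat.add_mod, Nat.mul_mod, Nat.pow_mod])
  omega

theorem eight_mul_triangular_add_one (k : ℕ) : 8 * (k * (k + 1) / 2) + 1 = (2 * k + 1) ^ 2 := by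
  have := Nat.div_mul_cancel (Nat.even_mul_succ_self k).two_dvd
  nlinarith

theorem four_mul_pentagonal_add (k : ℤ) :
    24 * (4 * pentagonal k) + 4 = (2 * (6 * k - 1)).natAbs ^ 2 := by
  have := two_mul_natCast_pentagonal k
  zify
  rw [sq_abs]
  linarith

theorem exists_four_mul_pentagonal_add_eq_sq {u : ℕ} (h : u % 12 = 2 ∨ u % 12 = 10) :
    ∃ k : ℤ, 24 * (4 * pentagonal k) + 4 = u ^ 2 := by
  simp only [four_mul_pentagonal_add]
  rcases h with h | h
  · exact ⟨-(u / 12 : ℕ), by congr 1; omega⟩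
  · exact ⟨(u / 12 : ℕ) + 1, by congr 1; omega⟩

/-- The `8`-regular partition function modulo `2`, by the pentagonal number theorem and Gauss's
triangular number identity. -/
theorem regularPartitionCount_eight_cast_eq_card_reps (n : ℕ) :
    (regularPartitionCount 8 n : ZMod 2) = (sqAddThreeSqReps (24 * n + 7)).card := by
  classical
  rw [regularPartitionCount_eight_cast]
  congr 1
  refine (Finset.card_bij (fun x _ => ((x.2 ^ 2 - 1) / 8, (x.1 ^ 2 - 4) / 24)) ?_ ?_ ?_).symm
  · rintro ⟨u, x⟩ hx
    replace hx : u ^ 2 + 3 * x ^ 2 = _ := mem_sqAddThreeSqReps.1 hx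
    obtain ⟨hx1, hu⟩ := residues_of_sq_add_three_sq (by omega) hx
    obtain ⟨k, hk⟩ := exists_four_mul_pentagonal_add_eq_sq hu
    have hl := eight_mul_triangular_add_one (x / 2)
    rw [show 2 * (x / 2) + 1 = x by omega] at hl
    simp only [Finset.mem_filter, Finset.HasAntidiagonal.mem_antidiagonal]
    exact ⟨by omega, ⟨x / 2, by omega⟩, ⟨k, by omega⟩⟩
  · rintro ⟨u, x⟩ hx ⟨u', x'⟩ hx' h
    replace hx : u ^ 2 + 3 * x ^ 2 = _ := mem_sqAddThreeSqReps.1 hx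
    replace hx' : u' ^ 2 + 3 * x' ^ 2 = _ := mem_sqAddThreeSqReps.1 hx'
    obtain ⟨hx1, hu⟩ := residues_of_sq_add_three_sq (by omega) hx
    obtain ⟨hx1', hu'⟩ := residues_of_sq_add_three_sq (by omega) hx'
    obtain ⟨k, hk⟩ := exists_four_mul_pentagonal_add_eq_sq hu
    obtain ⟨k', hk'⟩ := exists_four_mul_pentagonal_add_eq_sq hu'
    have hl := eight_mul_triangular_add_one (x / 2)
    have hl' := eight_mul_triangular_add_one (x' / 2)
    rw [show 2 * (x / 2) + 1 = x by omega] at hl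
    rw [show 2 * (x' / 2) + 1 = x' by omega] at hl'
    simp only [Prod.mk.injEq] at h ⊢
    have : u ^ 2 = u' ^ 2 := by omega
    have h2 : x ^ 2 = x' ^ 2 := by omega
    exact ⟨Nat.pow_left_injective two_ne_zero this, Nat.pow_left_injective two_ne_zero h2⟩
  · rintro ⟨i, j⟩ h
    simp only [Finset.mem_filter, Finset.HasAntidiagonal.mem_antidiagonal] at h
    obtain ⟨h, ⟨k, hk⟩, l, hl⟩ := h
    have h1 := eight_mul_triangular_add_one k
    have h2 := four_mul_pentagonal_add l
    exact ⟨((2 * (6 * l - 1)).natAbs, 2 * k + 1), mem_sqAddThreeSqReps.2 (by simp only; omega),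
      by simp only [Prod.mk.injEq]; omega⟩

/-! ### Primitive representations and square roots of -3 -/

/-- The square roots of `-3` modulo `M`. -/
def sqrtNegThree (M : ℕ) [NeZero M] : Finset (ZMod M) := {s | s ^ 2 = -3}

theorem mem_sqrtNegThree {M : ℕ} [NeZero M] {s : ZMod M} :
    s ∈ sqrtNegThree M ↔ s ^ 2 = -3 := by simp [sqrtNegThree]

theorem isUnit_two_and_three {M : ℕ} (hM : Nat.Coprime 6 M) :
    IsUnit (2 : ZMod M) ∧ IsUnit (3 : ZMod M) :=
  ⟨(ZMod.isUnit_iff_coprime 2 M).2 (hM.coprime_dvd_left (by norm_num)),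
    (ZMod.isUnit_iff_coprime 3 M).2 (hM.coprime_dvd_left (by norm_num))⟩

theorem coprime_six_of_mod {M : ℕ} (hM : M % 24 = 7) : Nat.Coprime 6 M := by
  rw [Nat.Coprime, Nat.gcd_rec, show M % 6 = 1 by omega]
  norm_num

/-- Thue's lemma. -/
theorem exists_small_eq_mul {M : ℕ} [NeZero M] (s : ZMod M) :
    ∃ a b : ℤ, (a ≠ 0 ∨ b ≠ 0) ∧ a.natAbs ≤ M.sqrt ∧ b.natAbs ≤ M.sqrt ∧ (a : ZMod M) = s * b := by
  let r := M.sqrt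
  let T := Finset.range (r + 1) ×ˢ Finset.range (r + 1)
  obtain ⟨x, hx, y, hy, hne, he⟩ := Finset.exists_ne_map_eq_of_card_lt_of_maps_to
    (s := T) (t := (Finset.univ : Finset (ZMod M)))
    (f := fun p => (p.1 : ZMod M) - s * p.2)
    -- Pigeonhole: (⌊√M⌋ + 1)² pairs exceed M residues.
    (by simpa [T, ZMod.card] using Nat.lt_succ_sqrt M) (fun _ _ => Finset.mem_coe.2 (Finset.mem_univ _))
  simp only [T, Finset.mem_product, Finset.mem_range] at hx hy
  refine ⟨x.1 - y.1, x.2 - y.2, ?_, by omega, by omega, ?_⟩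
  · by_contra! h
    exact hne (Prod.ext (by omega) (by omega))
  · push_cast
    linear_combination he

/-- With a = du and b = dv, the congruences force d(u² + 3v²) to divide u² + 3v², so d is a unit. -/
theorem gcd_eq_one_of_sq_add_three_sq {M : ℕ} (hM : 0 < M) {a b s : ℤ}
    (h : a ^ 2 + 3 * b ^ 2 = M) (hs : (M : ℤ) ∣ s ^ 2 + 3) (hab : (M : ℤ) ∣ a - s * b) :
    Int.gcd a b = 1 := by
  obtain ⟨d, hd⟩ : ∃ d : ℤ, d = Int.gcd a b := ⟨_, rfl⟩
  obtain ⟨u, hu⟩ : d ∣ a := hd ▸ Int.gcd_dvd_left ..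
  obtain ⟨v, hv⟩ : d ∣ b := hd ▸ Int.gcd_dvd_right ..
  have hM' : (M : ℤ) = d * (d * (u ^ 2 + 3 * v ^ 2)) := by rw [← h, hu, hv]; ring
  have hd0 : d ≠ 0 := by rintro h0; rw [h0] at hM'; simp at hM'; omega
  have hn0 : u ^ 2 + 3 * v ^ 2 ≠ 0 := by rintro h0; rw [h0] at hM'; simp at hM'; omega
  have h1 : d * (u ^ 2 + 3 * v ^ 2) ∣ u - s * v := by
    refine (mul_dvd_mul_iff_left hd0).1 ?_
    rw [← hM', mul_sub, ← hu, mul_left_comm, ← hv]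
    exact hab
  have h2 : d * (u ^ 2 + 3 * v ^ 2) ∣ s ^ 2 + 3 := (Dvd.intro_left d hM'.symm).trans hs
  have h3 : d * (u ^ 2 + 3 * v ^ 2) ∣ 1 * (u ^ 2 + 3 * v ^ 2) := by
    have := (h1.mul_right (u + s * v)).add (h2.mul_right (v ^ 2))
    rwa [show (u - s * v) * (u + s * v) + (s ^ 2 + 3) * v ^ 2 = 1 * (u ^ 2 + 3 * v ^ 2) by ring]
      at this
  have h4 : d ∣ 1 := (mul_dvd_mul_iff_right hn0).1 h3
  have : (Int.gcd a b : ℤ) ∣ (1 : ℕ) := by rw [← hd]; exact_mod_cast h4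
  exact Nat.dvd_one.1 (Int.natCast_dvd_natCast.1 this)

theorem exists_sq_add_three_sq_of_sq_eq_neg_three {M : ℕ} [NeZero M] (hM : M % 24 = 7)
    {s : ZMod M} (hs : s ^ 2 = -3) :
    ∃ a b : ℤ, a ^ 2 + 3 * b ^ 2 = M ∧ (a = s * b ∨ (a : ZMod M) = -(s * b)) := by
  obtain ⟨a, b, hne, ha, hb, hab⟩ := exists_small_eq_mul s
  -- Since 7 is not a square mod 24, the Thue bounds are strict, so a² + 3b² = tM with t < 4.
  have hr : M.sqrt ^ 2 < M := by
    refine lt_of_le_of_ne (Nat.sqrt_le' M) fun h => ?_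
    have : ∀ a < 24, a ^ 2 % 24 ≠ 7 := by decide
    exact this (M.sqrt % 24) (Nat.mod_lt _ (by norm_num)) (by rw [← Nat.pow_mod, h, hM])
  have ha2 : a ^ 2 < M := by
    have := Nat.pow_le_pow_left ha 2
    zify at this hr; rw [sq_abs] at this; omega
  have hb2 : b ^ 2 < M := by
    have := Nat.pow_le_pow_left hb 2
    zify at this hr; rw [sq_abs] at this; omega
  have hdvd : (M : ℤ) ∣ a ^ 2 + 3 * b ^ 2 := by
    rw [← ZMod.intCast_zmod_eq_zero_iff_dvd]
    push_cast
    rw [hab]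
    linear_combination (b : ZMod M) ^ 2 * hs
  obtain ⟨t, ht⟩ := hdvd
  have hpos : 0 < a ^ 2 + 3 * b ^ 2 := by
    rcases hne with h | h <;> positivity
  have hMpos : (0 : ℤ) < M := by omega
  have ht0 : 0 < t := by nlinarith
  have ht4 : t < 4 := by nlinarith
  interval_cases t
  · exact ⟨a, b, by linarith, Or.inl hab⟩
  · exfalso
    have key : ∀ x y : ZMod 4, x ^ 2 + 3 * y ^ 2 ≠ 2 := by decide
    apply key a b
    have := congrArg (Int.cast : ℤ → ZMod 4) ht
    push_cast at this
    rw [this, ← ZMod.natCast_mod M 4, show M % 4 = 3 by omega]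
    decide
  -- For t = 3, put a = 3c: then b² + 3c² = M, and the root changes sign.
  · have h3 : (3 : ℤ) ∣ a := by
      have : (3 : ℤ) ∣ a ^ 2 := ⟨M - b ^ 2, by linarith⟩
      exact Int.prime_three.dvd_of_dvd_pow this
    obtain ⟨c, rfl⟩ := h3
    refine ⟨b, c, by linarith, Or.inr ?_⟩
    have h3 := (isUnit_two_and_three (coprime_six_of_mod hM)).2
    refine h3.mul_left_cancel ?_
    push_cast at hab
    linear_combination s * hab + b * hs

/-- Composition gives M² = (ac + 3bd)² + 3(ad - bc)² with both bases divisible by M, which forces ad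
= bc. -/
theorem sq_add_three_sq_unique {M : ℕ} [NeZero M] {s : ZMod M} (hs : s ^ 2 = -3)
    {a b c d : ℤ} (h1 : a ^ 2 + 3 * b ^ 2 = M) (h2 : c ^ 2 + 3 * d ^ 2 = M)
    (hab : (a : ZMod M) = s * b) (hcd : (c : ZMod M) = s * d) : a ^ 2 = c ^ 2 ∧ b ^ 2 = d ^ 2 := by
  have hM : (M : ℤ) ≠ 0 := by exact_mod_cast NeZero.ne M
  obtain ⟨A, hA⟩ : (M : ℤ) ∣ a * c + 3 * b * d := by
    rw [← ZMod.intCast_zmod_eq_zero_iff_dvd]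
    push_cast
    rw [hab, hcd]
    linear_combination (b : ZMod M) * d * hs
  obtain ⟨B, hB⟩ : (M : ℤ) ∣ a * d - c * b := by
    rw [← ZMod.intCast_zmod_eq_zero_iff_dvd]
    push_cast
    rw [hab, hcd]
    ring
  have h : (M : ℤ) ^ 2 * (A ^ 2 + 3 * B ^ 2) = M ^ 2 * 1 := by
    calc _ = (M * A) ^ 2 + 3 * (M * B : ℤ) ^ 2 := by ring
      _ = (a ^ 2 + 3 * b ^ 2) * (c ^ 2 + 3 * d ^ 2) := by rw [← hA, ← hB]; ring
      _ = _ := by rw [h1, h2]; ring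
  have h := mul_left_cancel₀ (pow_ne_zero 2 hM) h
  have hB0 : B = 0 := by
    by_contra hB0
    have : 0 < B ^ 2 := by positivity
    nlinarith [sq_nonneg A]
  rw [hB0, mul_zero, sub_eq_zero] at hB
  have hbd : b ^ 2 = d ^ 2 := by
    apply mul_left_cancel₀ hM
    nth_rewrite 1 [← h2]
    rw [← h1]
    linear_combination -(a * d + c * b) * hB
  exact ⟨by linarith, hbd⟩

/-- The primitive representations `u ^ 2 + 3 * x ^ 2 = N` by natural numbers. -/
def primitiveSqAddThreeSqReps (N : ℕ) : Finset (ℕ × ℕ) :=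
  {x ∈ sqAddThreeSqReps N | Nat.Coprime x.1 x.2}

theorem mem_primitiveSqAddThreeSqReps {N : ℕ} {x : ℕ × ℕ} :
    x ∈ primitiveSqAddThreeSqReps N ↔ x.1 ^ 2 + 3 * x.2 ^ 2 = N ∧ Nat.Coprime x.1 x.2 := by
  rw [primitiveSqAddThreeSqReps, Finset.mem_filter, mem_sqAddThreeSqReps]

theorem ne_neg_of_mem_sqrtNegThree {M : ℕ} [NeZero M] (hM : Nat.Coprime 6 M) (h1 : M ≠ 1)
    {s : ZMod M} (hs : s ^ 2 = -3) : -s ≠ s := by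
  intro h
  have : Fact (1 < M) := ⟨by have := NeZero.ne M; omega⟩
  obtain ⟨h2, h3⟩ := isUnit_two_and_three hM
  have hs0 : s = 0 := (h2.mul_right_eq_zero).1 (by linear_combination -h)
  rw [hs0] at hs
  exact h3.ne_zero (by linear_combination hs)

theorem isUnit_of_mem_primitiveSqAddThreeSqReps {M u x : ℕ} (h : u ^ 2 + 3 * x ^ 2 = M)
    (hux : Nat.Coprime u x) : IsUnit (x : ZMod M) := by
  rw [ZMod.isUnit_iff_coprime, ← h]
  rw [show u ^ 2 + 3 * x ^ 2 = u ^ 2 + x * (3 * x) by ring, Nat.coprime_add_mul_left_right]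
  exact hux.symm.pow_right 2

theorem natAbs_cast_eq_or {R : Type*} [Ring R] (a : ℤ) :
    ((a.natAbs : ℕ) : R) = a ∨ ((a.natAbs : ℕ) : R) = -a := by
  rcases Int.natAbs_eq a with h | h
  · left; conv_rhs => rw [h]
    simp
  · right; conv_rhs => rw [h]
    simp

/-- Double counting: (u, x) meets exactly the two roots ±u/x, and each root meets exactly one pair,
signs being lost in ℕ. -/
theorem card_primitiveSqAddThreeSqReps_mul_two {M : ℕ} [NeZero M] (hM : M % 24 = 7) :
    (primitiveSqAddThreeSqReps M).card * 2 = (sqrtNegThree M).card := by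
  classical
  rw [← mul_one (sqrtNegThree M).card]
  refine Finset.card_mul_eq_card_mul
    (fun p s => (p.1 : ZMod M) = s * p.2 ∨ (p.1 : ZMod M) = -(s * p.2)) ?_ ?_
  · rintro ⟨u, x⟩ hp
    obtain ⟨h, hux⟩ := mem_primitiveSqAddThreeSqReps.1 hp
    obtain ⟨y, hy⟩ := (isUnit_of_mem_primitiveSqAddThreeSqReps h hux).exists_right_inv
    have hz : (u : ZMod M) ^ 2 + 3 * (x : ZMod M) ^ 2 = 0 := by
      have := congrArg (Nat.cast : ℕ → ZMod M) h
      push_cast at this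
      rw [this, ZMod.natCast_self]
    have hs : ((u : ZMod M) * y) ^ 2 = -3 := by
      linear_combination y ^ 2 * hz - 3 * (x * y + 1) * hy
    have hne := ne_neg_of_mem_sqrtNegThree (coprime_six_of_mod hM) (by omega) hs
    rw [show (sqrtNegThree M).bipartiteAbove _ (u, x) = {(u : ZMod M) * y, -(u * y)} from ?_,
      Finset.card_pair hne.symm]
    ext s
    simp only [Finset.mem_bipartiteAbove, mem_sqrtNegThree, Finset.mem_insert,
      Finset.mem_singleton]
    constructor
    · rintro ⟨_, h | h⟩
      · left; linear_combination -s * hy - y * h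
      · right; linear_combination -s * hy + y * h
    · rintro (rfl | rfl)
      · exact ⟨hs, Or.inl (by linear_combination -u * hy)⟩
      · exact ⟨by rw [neg_sq, hs], Or.inr (by linear_combination -u * hy)⟩
  · intro s hs
    rw [mem_sqrtNegThree] at hs
    rw [Finset.card_eq_one]
    obtain ⟨a, b, h, hab⟩ := exists_sq_add_three_sq_of_sq_eq_neg_three hM hs
    refine ⟨(a.natAbs, b.natAbs), ?_⟩
    rw [Finset.eq_singleton_iff_unique_mem]
    constructor
    · rw [Finset.mem_bipartiteBelow, mem_primitiveSqAddThreeSqReps]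
      refine ⟨⟨by zify; simpa using h, ?_⟩, ?_⟩
      · have hs' : (M : ℤ) ∣ (s.val : ℤ) ^ 2 + 3 := by
          rw [← ZMod.intCast_zmod_eq_zero_iff_dvd]
          push_cast
          rw [ZMod.natCast_zmod_val, hs]; ring
        rcases hab with hab | hab
        · refine gcd_eq_one_of_sq_add_three_sq (NeZero.pos M) h hs' ?_
          rw [← ZMod.intCast_zmod_eq_zero_iff_dvd]
          push_cast
          rw [ZMod.natCast_zmod_val, hab]; ring
        · refine gcd_eq_one_of_sq_add_three_sq (NeZero.pos M) h (s := -s.val)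
            (by simpa using hs') ?_
          rw [← ZMod.intCast_zmod_eq_zero_iff_dvd]
          push_cast
          rw [ZMod.natCast_zmod_val, hab]; ring
      · rcases natAbs_cast_eq_or (R := ZMod M) a with h1 | h1 <;>
        rcases natAbs_cast_eq_or (R := ZMod M) b with h2 | h2 <;>
        simp only [h1, h2] <;> rcases hab with hab | hab <;> simp [hab]
    · rintro ⟨u, x⟩ hp
      rw [Finset.mem_bipartiteBelow, mem_primitiveSqAddThreeSqReps] at hp
      obtain ⟨⟨h', -⟩, hux⟩ := hp
      simp only at h' hux
      obtain ⟨b', hb', hab'⟩ : ∃ b' : ℤ, b' ^ 2 = b ^ 2 ∧ (a : ZMod M) = s * b' := by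
        rcases hab with hab | hab
        · exact ⟨b, rfl, hab⟩
        · exact ⟨-b, by ring, by rw [hab]; push_cast; ring⟩
      obtain ⟨x', hx', hux'⟩ : ∃ x' : ℤ, x' ^ 2 = x ^ 2 ∧ (u : ZMod M) = s * x' := by
        rcases hux with hux | hux
        · exact ⟨x, rfl, by simpa using hux⟩
        · exact ⟨-x, by ring, by rw [hux]; push_cast; ring⟩
      obtain ⟨e1, e2⟩ := sq_add_three_sq_unique hs (a := u) (b := x') (c := a) (d := b')
        (by rw [hx']; exact_mod_cast h') (by rw [hb', h]) (by simpa using hux') hab'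
      rw [hx', hb'] at e2
      rw [← Int.natAbs_eq_iff_sq_eq] at e1 e2
      exact Prod.ext (by simpa using e1) (by simpa using e2)

/-! ### Counting the square roots of -3 -/

theorem even_card_sqrtNegThree {M : ℕ} [NeZero M] (hM : Nat.Coprime 6 M) (h1 : M ≠ 1) :
    Even (sqrtNegThree M).card := by
  rw [← ZMod.natCast_eq_zero_iff_even, Finset.card_eq_sum_ones, Nat.cast_sum]
  refine Finset.sum_involution (fun s _ => -s) (fun _ _ => by decide) (fun s hs _ => ?_)
    (fun s hs => ?_) (fun s _ => neg_neg s)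
  · exact ne_neg_of_mem_sqrtNegThree hM h1 (mem_sqrtNegThree.1 hs)
  · rw [mem_sqrtNegThree] at hs ⊢
    rw [neg_sq, hs]

theorem card_sqrtNegThree_mul {a b : ℕ} [NeZero a] [NeZero b] (h : a.Coprime b) :
    (sqrtNegThree (a * b)).card = (sqrtNegThree a).card * (sqrtNegThree b).card := by
  rw [← Finset.card_product]
  refine Finset.card_equiv (ZMod.chineseRemainder h).toEquiv fun s => ?_
  rw [Finset.mem_product, mem_sqrtNegThree, mem_sqrtNegThree, mem_sqrtNegThree,
    ← (ZMod.chineseRemainder h).injective.eq_iff, Prod.ext_iff]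
  have h3 : ZMod.chineseRemainder h 3 = 3 := map_ofNat _ 3
  simp [h3]

theorem exists_sq_eq_neg_three {p : ℕ} [Fact p.Prime] (hp : p % 3 = 1) :
    ∃ s : ZMod p, s ^ 2 = -3 := by
  have h3 : Fact (Nat.Prime 3) := ⟨Nat.prime_three⟩
  have hdvd : 3 ∣ Fintype.card (ZMod p)ˣ := by
    rw [ZMod.card_units]; omega
  obtain ⟨w, hw⟩ := exists_prime_orderOf_dvd_card 3 hdvd
  have h1 : (w : ZMod p) ^ 3 = 1 := by
    rw [← Units.val_pow_eq_pow_val, ← hw, pow_orderOf_eq_one, Units.val_one]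
  have h2 : (w : ZMod p) - 1 ≠ 0 := by
    intro h
    have : w = 1 := Units.ext (sub_eq_zero.1 h)
    rw [this, orderOf_one] at hw
    omega
  have h4 : (w : ZMod p) ^ 2 + w + 1 = 0 := by
    refine mul_left_cancel₀ h2 ?_
    linear_combination h1
  -- With w a primitive cube root of unity, 2w + 1 is √-3.
  exact ⟨2 * w + 1, by linear_combination 4 * h4⟩

theorem exists_prime_pow_dvd_sq_add_three {p : ℕ} (hp : p.Prime) (h3 : p % 3 = 1) (h2 : p ≠ 2)
    (k : ℕ) : ∃ s : ℤ, (p : ℤ) ^ (k + 1) ∣ s ^ 2 + 3 := by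
  have : Fact p.Prime := ⟨hp⟩
  induction k with
  | zero =>
    obtain ⟨s, hs⟩ := exists_sq_eq_neg_three h3
    refine ⟨s.val, ?_⟩
    rw [zero_add, pow_one, ← ZMod.intCast_zmod_eq_zero_iff_dvd]
    push_cast
    rw [ZMod.natCast_zmod_val, hs]; ring
  | succ k ih =>
    obtain ⟨s, c, hc⟩ := ih
    have hs : ¬ (p : ℤ) ∣ 2 * s := by
      intro h
      have hp' := Nat.prime_iff_prime_int.1 hp
      rcases hp'.dvd_or_dvd h with h | h
      · have := (Nat.prime_dvd_prime_iff_eq hp Nat.prime_two).1 (by exact_mod_cast h)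
        exact h2 this
      · have h4 : (p : ℤ) ∣ (3 : ℕ) := by
          have h5 : (p : ℤ) ∣ s ^ 2 + 3 := hc ▸ (dvd_pow_self _ k.succ_ne_zero).mul_right c
          exact (Int.dvd_add_right (h.trans (dvd_pow_self s two_ne_zero))).1 h5
        have := (Nat.prime_dvd_prime_iff_eq hp Nat.prime_three).1 (by exact_mod_cast h4)
        omega
    have hco : IsCoprime (2 * s) (p : ℤ) :=
      ((Nat.prime_iff_prime_int.1 hp).coprime_iff_not_dvd.2 hs).symm
    obtain ⟨x, y, hxy⟩ := hco
    -- Hensel step: x inverts 2s modulo p.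
    refine ⟨s - p ^ (k + 1) * (c * x), c * y + p ^ k * (c * x) ^ 2, ?_⟩
    linear_combination hc - p ^ (k + 1) * c * hxy

theorem card_sqrtNegThree_prime_pow {p k : ℕ} [NeZero (p ^ (k + 1))] (hp : p.Prime)
    (h3 : p % 3 = 1) (h2 : p ≠ 2) : (sqrtNegThree (p ^ (k + 1))).card = 2 := by
  classical
  obtain ⟨r, hr⟩ := exists_prime_pow_dvd_sq_add_three hp h3 h2 k
  have hco : Nat.Coprime 6 (p ^ (k + 1)) := by
    refine Nat.Coprime.pow_right _ (Nat.Coprime.symm ?_)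
    rw [hp.coprime_iff_not_dvd]
    intro h
    have : p ∣ 2 * 3 := h
    rcases hp.dvd_mul.1 this with h | h
    · exact h2 ((Nat.prime_dvd_prime_iff_eq hp Nat.prime_two).1 h)
    · have := (Nat.prime_dvd_prime_iff_eq hp Nat.prime_three).1 h
      omega
  have hr' : (r : ZMod (p ^ (k + 1))) ^ 2 = -3 := by
    have := (ZMod.intCast_zmod_eq_zero_iff_dvd (r ^ 2 + 3) (p ^ (k + 1))).2 (by exact_mod_cast hr)
    push_cast at this
    linear_combination this
  have hne := ne_neg_of_mem_sqrtNegThree hco (Nat.one_lt_pow k.succ_ne_zero hp.one_lt).ne' hr'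
  rw [show sqrtNegThree (p ^ (k + 1)) = {(r : ZMod (p ^ (k + 1))), -(r : ZMod (p ^ (k + 1)))} from ?_,
    Finset.card_pair hne.symm]
  ext s
  simp only [mem_sqrtNegThree, Finset.mem_insert, Finset.mem_singleton]
  constructor
  · intro hs
    obtain ⟨t, rfl⟩ := ZMod.intCast_surjective s
    have hdvd : (p : ℤ) ^ (k + 1) ∣ (t - r) * (t + r) := by
      have := (ZMod.intCast_zmod_eq_zero_iff_dvd ((t - r) * (t + r)) (p ^ (k + 1))).1 (by
        push_cast; linear_combination hs - hr')
      exact_mod_cast this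
    have hp' := Nat.prime_iff_prime_int.1 hp
    have key (z : ℤ) (h : (p : ℤ) ^ (k + 1) ∣ z) : (z : ZMod (p ^ (k + 1))) = 0 :=
      (ZMod.intCast_zmod_eq_zero_iff_dvd _ _).2 (by exact_mod_cast h)
    -- p cannot divide both factors: it would divide 2r, hence 12.
    by_cases h1 : (p : ℤ) ∣ t - r
    · left
      have h4 : ¬ (p : ℤ) ∣ t + r := by
        intro h4
        have h5 : (p : ℤ) ∣ 2 * r := by
          have := dvd_sub h4 h1
          rwa [show t + r - (t - r) = 2 * r by ring] at this
        have h6 : (p : ℤ) ∣ r ^ 2 + 3 := (dvd_pow_self _ k.succ_ne_zero).trans hr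
        have h7 : (p : ℤ) ∣ ((12 : ℕ) : ℤ) := by
          have := dvd_sub (h6.mul_left 4) (h5.mul_right (2 * r))
          rwa [show 4 * (r ^ 2 + 3) - 2 * r * (2 * r) = ((12 : ℕ) : ℤ) by push_cast; ring] at this
        have h8 : p ∣ 6 * 2 := Int.natCast_dvd_natCast.1 h7
        have h9 : Nat.Coprime p 6 := (Nat.Coprime.coprime_dvd_right (dvd_pow_self p k.succ_ne_zero) hco).symm
        exact h2 ((Nat.prime_dvd_prime_iff_eq hp Nat.prime_two).1 (h9.dvd_of_dvd_mul_left h8))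
      have := key _ (hp'.pow_dvd_of_dvd_mul_right (k + 1) h4 hdvd)
      push_cast at this
      linear_combination this
    · right
      have := key _ (hp'.pow_dvd_of_dvd_mul_left (k + 1) h1 hdvd)
      push_cast at this
      linear_combination this
  · rintro (rfl | rfl)
    · exact hr'
    · rw [neg_sq, hr']

/-! ### Parity of the representation counts -/

theorem eq_of_mul_sq_eq_seven : ∀ p t : ZMod 24, p * t ^ 2 = 7 → p = 7 := by decide

theorem mod_of_mul_sq_mod {p t N : ℕ} (h : p * t ^ 2 = N) (hN : N % 24 = 7) : p % 24 = 7 := by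
  have := eq_of_mul_sq_eq_seven p t (by
    have := congrArg (Nat.cast : ℕ → ZMod 24) h
    push_cast at this
    rw [this, ← ZMod.natCast_mod, hN]; rfl)
  have := (ZMod.natCast_eq_natCast_iff' p 7 24).1 (by exact_mod_cast this)
  omega

theorem sq_mod_ne {t N : ℕ} (h : t ^ 2 = N) : N % 24 ≠ 7 := by
  rw [← h, Nat.pow_mod]
  have : ∀ a < 24, a ^ 2 % 24 ≠ 7 := by decide
  exact this _ (Nat.mod_lt _ (by norm_num))

theorem odd_card_primitiveSqAddThreeSqReps_iff {M : ℕ} (hM : M % 24 = 7) :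
    Odd (primitiveSqAddThreeSqReps M).card ↔ IsPrimePow M := by
  have : NeZero M := ⟨by omega⟩
  have hcard := card_primitiveSqAddThreeSqReps_mul_two hM
  have hco := coprime_six_of_mod hM
  constructor
  · intro hodd
    by_contra hpp
    obtain ⟨a, b, hab, rfl, ha, hb⟩ : ∃ a b, Nat.Coprime a b ∧ a * b = M ∧ a ≠ 1 ∧ b ≠ 1 := by
      have h1 : M ≠ 1 := by omega
      have hq := Nat.minFac_prime h1
      refine ⟨M.minFac ^ M.factorization M.minFac, M / M.minFac ^ M.factorization M.minFac,
        (Nat.coprime_ordCompl hq (NeZero.ne M)).pow_left _,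
        Nat.ordProj_mul_ordCompl_eq_self M _, ?_, ?_⟩
      · have := hq.factorization_pos_of_dvd (NeZero.ne M) (Nat.minFac_dvd M)
        exact (Nat.one_lt_pow this.ne' hq.one_lt).ne'
      · intro h
        apply hpp
        have h5 := Nat.ordProj_mul_ordCompl_eq_self M M.minFac
        rw [h, mul_one] at h5
        rw [← h5]
        have := hq.factorization_pos_of_dvd (NeZero.ne M) (Nat.minFac_dvd M)
        exact hq.isPrimePow.pow this.ne'
    have hane : NeZero a := ⟨by rintro rfl; simp at hM⟩
    have hbne : NeZero b := ⟨by rintro rfl; simp at hM⟩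
    -- Both factors are even, so twice the primitive count is divisible by 4.
    rw [card_sqrtNegThree_mul hab] at hcard
    obtain ⟨x, hx⟩ := even_card_sqrtNegThree (hco.coprime_dvd_right (Dvd.intro _ rfl)) ha
    obtain ⟨y, hy⟩ := even_card_sqrtNegThree (hco.coprime_dvd_right (Dvd.intro_left _ rfl)) hb
    rw [hx, hy] at hcard
    have : (primitiveSqAddThreeSqReps (a * b)).card = 2 * (x * y) := by linarith
    rw [this] at hodd
    exact Nat.not_odd_iff_even.2 (even_two_mul _) hodd
  · rw [isPrimePow_nat_iff]
    rintro ⟨p, k, hp, hk, rfl⟩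
    obtain ⟨l, rfl⟩ : ∃ l, k = 2 * l + 1 := by
      rcases Nat.even_or_odd k with ⟨l, rfl⟩ | h
      · exact absurd hM (sq_mod_ne (t := p ^ l) (by ring))
      · exact h
    have h7 : p % 24 = 7 := mod_of_mul_sq_mod (t := p ^ l) (by ring) hM
    rw [card_sqrtNegThree_prime_pow hp (by omega) (by omega)] at hcard
    rw [show (primitiveSqAddThreeSqReps (p ^ (2 * l + 1))).card = 1 by omega]
    exact odd_one

theorem card_sqAddThreeSqReps_eq_sum {N : ℕ} (hN : 0 < N) :
    (sqAddThreeSqReps N).card =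
      ∑ d ∈ N.divisors with d ^ 2 ∣ N, (primitiveSqAddThreeSqReps (N / d ^ 2)).card := by
  have hdvd {x : ℕ × ℕ} (h : x.1 ^ 2 + 3 * x.2 ^ 2 = N) : Nat.gcd x.1 x.2 ^ 2 ∣ N := by
    rw [← h]
    exact dvd_add (pow_dvd_pow_of_dvd (Nat.gcd_dvd_left ..) 2)
      ((pow_dvd_pow_of_dvd (Nat.gcd_dvd_right ..) 2).mul_left 3)
  rw [Finset.card_eq_sum_card_fiberwise (f := fun x => Nat.gcd x.1 x.2)
    (t := {d ∈ N.divisors | d ^ 2 ∣ N})]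
  · refine Finset.sum_congr rfl fun d hd => ?_
    rw [Finset.mem_filter, Nat.mem_divisors] at hd
    obtain ⟨M, rfl⟩ := hd.2
    have hd0 : 0 < d := Nat.pos_of_ne_zero (by rintro rfl; simp at hN)
    rw [Nat.mul_div_cancel_left _ (pow_pos hd0 2)]
    refine (Finset.card_bij (fun x _ => (d * x.1, d * x.2)) ?_ ?_ ?_).symm
    · rintro ⟨u, x⟩ hx
      obtain ⟨h, hux⟩ := mem_primitiveSqAddThreeSqReps.1 hx
      rw [Finset.mem_filter, mem_sqAddThreeSqReps]
      refine ⟨by rw [← h]; ring, ?_⟩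
      rw [Nat.gcd_mul_left, hux, mul_one]
    · rintro ⟨u, x⟩ - ⟨v, y⟩ - h
      simpa [hd0.ne'] using h
    · rintro ⟨u, x⟩ h
      rw [Finset.mem_filter, mem_sqAddThreeSqReps] at h
      obtain ⟨h, hg⟩ := h
      obtain ⟨u', hu⟩ : d ∣ u := hg ▸ Nat.gcd_dvd_left ..
      obtain ⟨x', hx⟩ : d ∣ x := hg ▸ Nat.gcd_dvd_right ..
      subst hu hx
      refine ⟨(u', x'), mem_primitiveSqAddThreeSqReps.2 ⟨?_, ?_⟩, rfl⟩
      · refine Nat.eq_of_mul_eq_mul_left (pow_pos hd0 2) ?_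
        rw [← h]; ring
      · simp only [Nat.gcd_mul_left] at hg
        exact Nat.eq_of_mul_eq_mul_left hd0 (by rw [hg, mul_one])
  · intro x hx
    have h := hdvd (mem_sqAddThreeSqReps.1 hx)
    simp only [Finset.coe_filter, Nat.mem_divisors, Set.mem_ofPred_eq]
    exact ⟨⟨(dvd_pow_self _ two_ne_zero).trans h, hN.ne'⟩, h⟩

/-- The admissible `d` are `p ^ i * m` with `i ≤ c`, leaving the quotient `p ^ (2 * (c - i) + 1)`.
-/
theorem card_divisors_div_sq_isPrimePow {p m c N : ℕ} (hp : p.Prime) (hpm : ¬ p ∣ m)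
    (hN0 : 0 < N) (hN : N = p ^ (2 * c + 1) * m ^ 2) :
    ({d ∈ N.divisors | d ^ 2 ∣ N ∧ IsPrimePow (N / d ^ 2)}).card = c + 1 := by
  classical
  have hm0 : 0 < m := Nat.pos_of_ne_zero (by rintro rfl; simp at hpm)
  rw [← Finset.card_range (c + 1)]
  refine (Finset.card_bij (fun i _ => p ^ i * m) ?_ ?_ ?_).symm
  · intro i hi
    rw [Finset.mem_range] at hi
    have h : N = (p ^ i * m) ^ 2 * p ^ (2 * (c - i) + 1) := by
      rw [hN, show 2 * c + 1 = i * 2 + (2 * (c - i) + 1) by omega, pow_add]; ring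
    have h2 : (p ^ i * m) ^ 2 ∣ N := ⟨_, h⟩
    rw [Finset.mem_filter, Nat.mem_divisors]
    refine ⟨⟨(dvd_pow_self _ two_ne_zero).trans h2, hN0.ne'⟩, h2, ?_⟩
    rw [h, Nat.mul_div_cancel_left _ (pow_pos (mul_pos (pow_pos hp.pos i) hm0) 2)]
    exact hp.isPrimePow.pow (by omega)
  · intro i _ j _ h
    exact Nat.pow_right_injective hp.two_le (Nat.eq_of_mul_eq_mul_right hm0 h)
  · intro d hd
    rw [Finset.mem_filter] at hd
    obtain ⟨-, ⟨M, hM⟩, hpp⟩ := hd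
    have hd0 : 0 < d := Nat.pos_of_ne_zero (by rintro rfl; simp at hM; omega)
    rw [hM, Nat.mul_div_cancel_left _ (pow_pos hd0 2)] at hpp
    obtain ⟨q, k, hq, hk, rfl⟩ := (isPrimePow_nat_iff _).1 hpp
    have hf : 2 * c + 1 = 2 * d.factorization p + k * q.factorization p := by
      have := congrArg (fun n => n.factorization p) (hN.symm.trans hM)
      simpa [Nat.factorization_mul, hp.ne_zero, hm0.ne', hd0.ne', hq.ne_zero, hp.factorization_self,
        Nat.factorization_eq_zero_of_not_dvd hpm] using this
    -- Otherwise the odd exponent of p in N would equal twice its exponent in d.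
    obtain rfl : q = p := by
      by_contra hqp
      rw [Nat.factorization_eq_zero_of_not_dvd (n := q) (p := p)
        fun h => hqp ((Nat.prime_dvd_prime_iff_eq hp hq).1 h).symm] at hf
      omega
    rw [hp.factorization_self, mul_one] at hf
    refine ⟨d.factorization q, Finset.mem_range.2 (by omega), ?_⟩
    obtain ⟨d', hd'⟩ := Nat.ordProj_dvd d q
    have h : q ^ (2 * c + 1) * m ^ 2 = q ^ (2 * c + 1) * d' ^ 2 := by
      rw [← hN, hM, hf, pow_add]
      nth_rewrite 1 [hd']
      ring
    have h2 := Nat.pow_left_injective two_ne_zero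
      (Nat.eq_of_mul_eq_mul_left (pow_pos hp.pos _) h)
    rw [h2, ← hd']

theorem exists_eq_prime_pow_mul_sq {N d : ℕ} (hN : N % 24 = 7) (hd : d ^ 2 ∣ N)
    (h : IsPrimePow (N / d ^ 2)) :
    ∃ p c m : ℕ, p.Prime ∧ ¬ p ∣ m ∧ N = p ^ (2 * c + 1) * m ^ 2 := by
  obtain ⟨M, rfl⟩ := hd
  have hd0 : 0 < d := Nat.pos_of_ne_zero (by rintro rfl; simp at hN)
  rw [Nat.mul_div_cancel_left _ (pow_pos hd0 2)] at h
  obtain ⟨p, k, hp, hk, rfl⟩ := (isPrimePow_nat_iff _).1 h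
  obtain ⟨l, rfl⟩ : ∃ l, k = 2 * l + 1 := by
    rcases Nat.even_or_odd k with ⟨l, rfl⟩ | h
    · exact absurd hN (sq_mod_ne (t := d * p ^ l) (by ring))
    · exact h
  obtain ⟨i, m, hm, rfl⟩ := Nat.exists_eq_pow_mul_and_not_dvd hd0.ne' p hp.ne_one
  exact ⟨p, i + l, m, hp, hm, by ring⟩

theorem odd_card_sqAddThreeSqReps_iff {N : ℕ} (hN : N % 24 = 7) :
    Odd (sqAddThreeSqReps N).card ↔
      Odd ({d ∈ N.divisors | d ^ 2 ∣ N ∧ IsPrimePow (N / d ^ 2)}).card := by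
  classical
  have key (d : ℕ) (h : d ^ 2 ∣ N) :
      Odd (primitiveSqAddThreeSqReps (N / d ^ 2)).card ↔ IsPrimePow (N / d ^ 2) := by
    obtain ⟨M, rfl⟩ := h
    have hd0 : 0 < d := Nat.pos_of_ne_zero (by rintro rfl; simp at hN)
    rw [Nat.mul_div_cancel_left _ (pow_pos hd0 2)]
    exact odd_card_primitiveSqAddThreeSqReps_iff (mod_of_mul_sq_mod (mul_comm _ _) hN)
  rw [card_sqAddThreeSqReps_eq_sum (by omega), Finset.odd_sum_iff_odd_card_odd,
    Finset.filter_filter]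
  simp only [and_congr_right_iff.2 (key _)]

theorem theorem1p1 (n : ℕ) (hn : 0 < n) :
    (Odd (regularPartitionCount 8 n) ↔
      ∃ p a m : ℕ, p.Prime ∧ ¬ p ∣ m ∧ 24 * n + 7 = p ^ (4 * a + 1) * m ^ 2) ∧
    (∀ p a m : ℕ, p.Prime → ¬ p ∣ m → 24 * n + 7 = p ^ (4 * a + 1) * m ^ 2 →
      p ≡ 7 [MOD 24]) := by
  have hN : (24 * n + 7) % 24 = 7 := by omega
  refine ⟨?_, fun p a m _ _ h => mod_of_mul_sq_mod (t := p ^ (2 * a) * m) (by rw [h]; ring) hN⟩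
  rw [← ZMod.natCast_eq_one_iff_odd, regularPartitionCount_eight_cast_eq_card_reps,
    ZMod.natCast_eq_one_iff_odd, odd_card_sqAddThreeSqReps_iff hN]
  constructor
  · intro hodd
    obtain ⟨d, hd⟩ := Finset.card_pos.1 hodd.pos
    rw [Finset.mem_filter] at hd
    obtain ⟨p, c, m, hp, hpm, h⟩ := exists_eq_prime_pow_mul_sq hN hd.2.1 hd.2.2
    rw [card_divisors_div_sq_isPrimePow hp hpm (by omega) h] at hodd
    obtain ⟨a, ha⟩ := hodd
    exact ⟨p, a, m, hp, hpm, by rw [h, show c = 2 * a by omega]; ring⟩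
  · rintro ⟨p, a, m, hp, hpm, h⟩
    rw [card_divisors_div_sq_isPrimePow (c := 2 * a) hp hpm (by omega) (by rw [h]; ring)]
    exact odd_two_mul_add_one a
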